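/- Let $K$ be a field of characteristic $2$. For $n\ge 1$ let $\mathfrak g=\mathfrak o^{(1)}_I(n)=[\mathfrak o_I(n),\mathfrak o_I(n)]$ be the derived algebra of the Lie algebra $\mathfrak o_I(n)=\{A\in\mathfrak{gl}(n,K) : A^T=-A\}$ of matrices preserving the bilinear form with Gram matrix $1_n$. Put $X_{i,j}=E^{i,j}+E^{j,i}$ for $i\neq j$; the $X_{i,j}$ with $i<j$ form a basis of $\mathfrak g$, with dual basis $dX_{i,j}$ (and $dX_{j,i}=dX_{i,j}$), and $X_{i,j}\otimes dX_{k,l}$ denotes the $1$-cochain $A\mapsto dX_{k,l}(A)\,X_{i,j}$ on $\mathfrak g$ with values in the adjoint module. For $1\le k\le n$ let $$c_k=\sum_{j\neq k}X_{k,j}\otimes dX_{k,j}.$$ (a) If $n\neq 4$, then $c_1,\dots,c_{n-1}$ are cocycles and their classes form a basis of $H^1(\mathfrak g;\mathfrak g)$; in particular $\dim H^1(\mathfrak g;\mathfrak g)=n-1$. (b) If $n=4$, then $c_1,c_2,c_3$ and the three exceptional cochains $$X_{1,2}\otimes dX_{3,4}+X_{1,3}\otimes dX_{2,4}+X_{2,3}\otimes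 dX_{1,4},$$ $$X_{1,2}\otimes dX_{3,4}+X_{1,4}\otimes dX_{2,3}+X_{2,4}\otimes dX_{1,3},$$ $$X_{1,3}\otimes dX_{2,4}+X_{1,4}\otimes dX_{2,3}+X_{3,4}\otimes dX_{1,2}$$ are cocycles and their classes form a basis of $H^1(\mathfrak g;\mathfrak g)$. (c) All these cocycles have degree $0$: for every $n\ge1$, the $c_k$ preserve every grading of the Lie algebra $\mathfrak g$ by an abelian group for which all $X_{i,j}$ are homogeneous, and for $n=4$ the exceptional cocycles preserve every $\mathbb Z$-grading of the Lie algebra $\mathfrak g$ for which all $X_{i,j}$ are homogeneous. -/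

import Mathlib

open LieModule.Cohomology

attribute [local instance 100] LieRing.ofAssociativeRing

/-- The differential `d₀₁ : M → C¹(L; M)`, `m ↦ (x ↦ ⁅x, m⁆)`. -/
def coboundaryZero (R L M : Type*) [CommRing R] [LieRing L] [LieAlgebra R L]
    [AddCommGroup M] [Module R M] [LieRingModule L M] [LieModule R L M] :
    M →ₗ[R] oneCochain R L M where
  toFun m :=
    { toFun := fun x => ⁅x, m⁆
      map_add' := fun x y => add_lie x y m
      map_smul' := fun t x => smul_lie t x m }
  map_add' m m' := by ext x; exact lie_add x m m'
  map_smul' t m := by ext x; exact lie_smul t x m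

/-- The 1-cocycles `Z¹(L; M) = ker d₁₂`. -/
def oneCocycles (R L M : Type*) [CommRing R] [LieRing L] [LieAlgebra R L]
    [AddCommGroup M] [Module R M] [LieRingModule L M] [LieModule R L M] :
    Submodule R (oneCochain R L M) :=
  LinearMap.ker (d₁₂ R L M)

/-- The 1-coboundaries `B¹(L; M) = im d₀₁`. -/
def oneCoboundaries (R L M : Type*) [CommRing R] [LieRing L] [LieAlgebra R L]
    [AddCommGroup M] [Module R M] [LieRingModule L M] [LieModule R L M] :
    Submodule R (oneCochain R L M) :=
  LinearMap.range (coboundaryZero R L M)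

theorem oneCoboundaries_le_oneCocycles (R L M : Type*) [CommRing R] [LieRing L] [LieAlgebra R L]
    [AddCommGroup M] [Module R M] [LieRingModule L M] [LieModule R L M] :
    oneCoboundaries R L M ≤ oneCocycles R L M := by
  rintro _ ⟨m, rfl⟩
  refine LinearMap.mem_ker.mpr (Subtype.ext ?_)
  ext x y
  change ⁅x, ⁅y, m⁆⁆ - ⁅y, ⁅x, m⁆⁆ - ⁅⁅x, y⁆, m⁆ = 0
  rw [lie_lie, sub_self]

/-- The cohomology space `H¹(L; M) = Z¹(L; M) / B¹(L; M)`. -/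
abbrev FirstCohomology (R L M : Type*) [CommRing R] [LieRing L] [LieAlgebra R L]
    [AddCommGroup M] [Module R M] [LieRingModule L M] [LieModule R L M] : Type _ :=
  oneCocycles R L M ⧸ (oneCoboundaries R L M).submoduleOf (oneCocycles R L M)

/-- The class in `H¹(L; M)` of a 1-cocycle. -/
def cohomologyClass {R L M : Type*} [CommRing R] [LieRing L] [LieAlgebra R L]
    [AddCommGroup M] [Module R M] [LieRingModule L M] [LieModule R L M]
    (f : oneCochain R L M) (hf : f ∈ oneCocycles R L M) : FirstCohomology R L M :=
  Submodule.Quotient.mk ⟨f, hf⟩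

/-- A 1-cochain `L → L` has degree `d` for the grading `𝒢` of `L` if it maps `𝒢 i` into
`𝒢 (i + d)` for all `i`. -/
def HasDegree {Γ R L : Type*} [Add Γ] [CommRing R] [LieRing L] [LieAlgebra R L]
    (𝒢 : Γ → Submodule R L) (d : Γ) (f : oneCochain R L L) : Prop :=
  ∀ i, ∀ x ∈ 𝒢 i, f x ∈ 𝒢 (i + d)

/-- `𝔬_I(n)`: the Lie algebra of the `n × n` matrices `A` that preserve the symmetric bilinear form
with Gram matrix `1`, that is, with `Aᵀ = -A`. -/
abbrev OI (K : Type*) [Field K] (n : ℕ) : LieSubalgebra K (Matrix (Fin n) (Fin n) K) :=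
  LieAlgebra.Orthogonal.so (Fin n) K

/-- `𝔬_I^{(1)}(n) = [𝔬_I(n), 𝔬_I(n)]`, the derived algebra of `𝔬_I(n)`. -/
abbrev OI1 (K : Type*) [Field K] (n : ℕ) : LieIdeal K (OI K n) :=
  LieAlgebra.derivedSeries K (OI K n) 1

/-- The underlying matrix of an element of `𝔬_I^{(1)}(n)`. -/
def OI1.toMatrix {K : Type*} [Field K] {n : ℕ} :
    OI1 K n →ₗ[K] Matrix (Fin n) (Fin n) K :=
  (OI K n).toSubmodule.subtype ∘ₗ (OI1 K n).toSubmodule.subtype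

section CharTwo

variable {K : Type*} [Field K] [CharP K 2] {n : ℕ}

theorem OI.symm_mem {A : Matrix (Fin n) (Fin n) K} (hA : A.transpose = A) : A ∈ OI K n := by
  rw [LieAlgebra.Orthogonal.mem_so, hA]
  ext i j
  exact (CharTwo.neg_eq _).symm

theorem OI1.matrixX_mem_OI (i j : Fin n) :
    (Matrix.single i j 1 + Matrix.single j i 1 : Matrix (Fin n) (Fin n) K) ∈ OI K n :=
  OI.symm_mem (by
    rw [Matrix.transpose_add, Matrix.transpose_single, Matrix.transpose_single, add_comm])

theorem OI1.matrixX_mem_OI1 (i j : Fin n) :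
    (⟨Matrix.single i j 1 + Matrix.single j i 1, OI1.matrixX_mem_OI i j⟩ : OI K n) ∈ OI1 K n := by
  by_cases hij : i = j
  · subst hij
    convert (OI1 K n).zero_mem using 1
    ext a b
    exact CharTwo.add_self_eq_zero _
  · have hE : (Matrix.single i i 1 : Matrix (Fin n) (Fin n) K) ∈ OI K n :=
      OI.symm_mem (Matrix.transpose_single _ _ _)
    have h : (⟨Matrix.single i j 1 + Matrix.single j i 1, OI1.matrixX_mem_OI i j⟩ : OI K n)
        = ⁅(⟨_, hE⟩ : OI K n), ⟨_, OI1.matrixX_mem_OI i j⟩⁆ := by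
      apply Subtype.ext
      change _ = Matrix.single i i 1 * (Matrix.single i j 1 + Matrix.single j i 1)
        - (Matrix.single i j 1 + Matrix.single j i 1) * Matrix.single i i 1
      have hji : j ≠ i := fun h => hij h.symm
      rw [mul_add, add_mul, Matrix.single_mul_single_same, Matrix.single_mul_single_same,
        Matrix.single_mul_single_of_ne (1 : K) _ _ _ hij,
        Matrix.single_mul_single_of_ne (1 : K) _ _ _ hji, mul_one]
      ext a b
      simp [sub_eq_add_neg, CharTwo.neg_eq]
    rw [h]
    exact LieSubmodule.lie_mem_lie (LieSubmodule.mem_top _) (LieSubmodule.mem_top _)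

/-- `X_{i,j} = E^{i,j} + E^{j,i}` as an element of `𝔬_I^{(1)}(n)` (it is `0` if `i = j`). -/
def OI1.X (i j : Fin n) : OI1 K n :=
  ⟨⟨Matrix.single i j 1 + Matrix.single j i 1, OI1.matrixX_mem_OI i j⟩, OI1.matrixX_mem_OI1 i j⟩

/-- For `k ≠ l`, the element `dX_{k,l}` of the basis dual to the `X_{i,j}` with `i < j`: the
functional `A ↦ A k l` on `𝔬_I^{(1)}(n)`. -/
def OI1.dX (k l : Fin n) : OI1 K n →ₗ[K] K where
  toFun A := OI1.toMatrix A k l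
  map_add' A B := by rw [map_add]; rfl
  map_smul' t A := by rw [map_smul]; rfl

theorem OI1.dX_X (i j k l : Fin n) (hij : i ≠ j) :
    OI1.dX (K := K) k l (OI1.X i j) = if (i = k ∧ j = l) ∨ (i = l ∧ j = k) then 1 else 0 := by
  change (Matrix.single i j 1 + Matrix.single j i 1 : Matrix (Fin n) (Fin n) K) k l = _
  simp only [Matrix.add_apply, Matrix.single_apply]
  grind

/-- The 1-cochain `X_{i,j} ⊗ dX_{k,l}`, that is, `A ↦ dX_{k,l}(A) X_{i,j}`. -/
def OI1.XdX (i j k l : Fin n) : oneCochain K (OI1 K n) (OI1 K n) :=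
  (OI1.dX k l).smulRight (OI1.X i j)

/-- The 1-cochain `∑_{j ≠ k} X_{k,j} ⊗ dX_{k,j}`. -/
def OI1.regularCochain (k : Fin n) : oneCochain K (OI1 K n) (OI1 K n) :=
  ∑ j ∈ Finset.univ.erase k, OI1.XdX k j k j

/-- The three exceptional 1-cochains for `n = 4`; the indices `1, 2, 3, 4` are `0, 1, 2, 3` here. -/
def OI1.exceptionalCochain : Fin 3 → oneCochain K (OI1 K 4) (OI1 K 4) :=
  ![OI1.XdX 0 1 2 3 + OI1.XdX 0 2 1 3 + OI1.XdX 1 2 0 3,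
    OI1.XdX 0 1 2 3 + OI1.XdX 0 3 1 2 + OI1.XdX 1 3 0 2,
    OI1.XdX 0 2 1 3 + OI1.XdX 0 3 1 2 + OI1.XdX 2 3 0 1]

end CharTwo

/-- The 1-cochains `c i : L → L` are cocycles whose classes form a basis of `H¹(L; L)`. -/
def IsCohomologyBasis {ι R L : Type*} [CommRing R] [LieRing L] [LieAlgebra R L]
    (c : ι → oneCochain R L L) : Prop :=
  ∃ hc : ∀ i, c i ∈ oneCocycles R L L,
    LinearIndependent R (fun i => cohomologyClass (c i) (hc i)) ∧
    Submodule.span R (Set.range fun i => cohomologyClass (c i) (hc i)) = ⊤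

/-!
# First cohomology of `𝔬_I^{(1)}(n)` in characteristic two

In characteristic two `𝔤 = 𝔬_I^{(1)}(n)` is the space of symmetric matrices with zero diagonal, and
a `1`-cocycle `f` with values in the adjoint module is a derivation. It is determined by the
coefficients `f^{pq}_{ij}` of `X_{p,q}` in `f X_{i,j}`, and the relation
`f X_{i,k} = [f X_{i,j}, X_{j,k}] + [X_{i,j}, f X_{j,k}]` for distinct `i, j, k`
(`OI1.dX_cocycle_X`), read entry by entry, separates three types of coefficients.

* `{p, q} = {i, j}`: the diagonal coefficients `d_{ij}` satisfy `d_{ik} = d_{ij} + d_{jk}`, hence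
  `d_{ij} = a_i + a_j` with `a_n = 0` (`OI1.exists_diagonal_coeff`). Since `c_k` is diagonal with
  eigenvalue `δ_{ik} + δ_{jk}` on `X_{i,j}`, this part of `f` is `∑ a_k c_k`.
* `{p, q}` and `{i, j}` share one index: the coefficient of `X_{p,i}` in `f X_{i,k}` depends only on
  the unordered pair `{p, k}`, so it is the entry of an element `m` of `𝔤`, and this part of `f` is
  `ad m` (`OI1.exists_inner_coeff`).
* `{p, q}` and `{i, j}` are disjoint: if `n ≥ 5` there is an index outside all of them, and the
  coefficient vanishes (`OI1.dX_cocycle_X_of_disjoint`); if `n ≤ 3` there are no such pairs. If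
  `n = 4`, then `{p, q}` is the complement of `{i, j}`, the coefficients `x_{ij}` satisfy
  `x_{ik} = x_{ij} + x_{jk}`, and the three-dimensional space of solutions is spanned by the
  exceptional cochains (`OI1.eq_sum_exceptionalCochain`).

Inner derivations only have coefficients of the second type, so the `c_k` and the exceptional
cochains are independent modulo coboundaries.

As for degrees, the `X_{i,j}` are eigenvectors of `c_k`, so `c_k` preserves every grading for which
they are homogeneous. If `n ≥ 3` and the grading group is torsion-free, `[X_{i,j}, X_{j,k}] = X_{i,k}`
and `[X_{i,k}, X_{k,j}] = X_{i,j}` give `2 deg X_{j,k} = 0`, so all of `𝔤` has degree `0`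
(`OI1.X_mem_zero`), and every cochain has degree `0`.
-/

/-! ### Matrix entries -/

theorem OI.apply_comm {K : Type*} [Field K] [CharP K 2] {n : ℕ} (a : OI K n) (i j : Fin n) :
    a.1 i j = a.1 j i := by
  have h := congrFun (congrFun ((LieAlgebra.Orthogonal.mem_so (Fin n) K _).1 a.2) j) i
  rwa [Matrix.neg_apply, CharTwo.neg_eq] at h

namespace OI1

variable {K : Type*} [Field K] {n : ℕ}

theorem ext_dX {x y : OI1 K n} (h : ∀ i j, dX i j x = dX i j y) : x = y :=
  Subtype.ext (Subtype.ext (Matrix.ext h))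

theorem dX_lie (x y : OI1 K n) (p q : Fin n) :
    dX p q ⁅x, y⁆ = ∑ r, (dX p r x * dX r q y - dX p r y * dX r q x) := by
  rw [Finset.sum_sub_distrib]
  rfl

variable [CharP K 2]

theorem dX_comm (x : OI1 K n) (i j : Fin n) : dX i j x = dX j i x :=
  OI.apply_comm x.1 i j

/-- The elements of the derived algebra have zero diagonal: the diagonal entries of a commutator of
two symmetric matrices vanish. -/
theorem dX_self (x : OI1 K n) (i : Fin n) : dX i i x = 0 := by
  -- An element of `[𝔬, 𝔬]` is a linear combination of commutators.
  have hx : (x : OI K n) ∈ LieAlgebra.derivedSeries K (OI K n) 1 := x.2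
  rw [LieAlgebra.derivedSeries_def, LieAlgebra.derivedSeriesOfIdeal_succ,
    LieAlgebra.derivedSeriesOfIdeal_zero, ← LieSubmodule.mem_toSubmodule,
    LieSubmodule.lieIdeal_oper_eq_linear_span'] at hx
  change ((x : OI K n) : Matrix (Fin n) (Fin n) K) i i = 0
  generalize (x : OI K n) = y at hx
  induction hx using Submodule.span_induction with
  | mem z hz =>
    obtain ⟨a, -, b, -, rfl⟩ := hz
    change ∑ r, a.1 i r * b.1 r i - ∑ r, b.1 i r * a.1 r i = 0
    rw [sub_eq_zero]
    refine Finset.sum_congr rfl fun r _ => ?_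
    rw [OI.apply_comm a i r, OI.apply_comm b r i, mul_comm]
  | zero => rfl
  | add a b _ _ ha hb =>
    change a.1 i i + b.1 i i = 0
    rw [ha, hb, add_zero]
  | smul t a _ ha =>
    change t * a.1 i i = 0
    rw [ha, mul_zero]

theorem dX_X_eq_add (i j p q : Fin n) :
    dX p q (X i j : OI1 K n) =
      (if i = p ∧ j = q then 1 else 0) + (if j = p ∧ i = q then 1 else 0) := by
  change (Matrix.single i j 1 + Matrix.single j i 1 : Matrix (Fin n) (Fin n) K) p q = _
  simp only [Matrix.add_apply, Matrix.single_apply]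

theorem X_comm (i j : Fin n) : (X i j : OI1 K n) = X j i :=
  ext_dX fun p q => by rw [dX_X_eq_add, dX_X_eq_add, add_comm]

theorem dX_lie_X (x : OI1 K n) (i j p q : Fin n) :
    dX p q ⁅x, X i j⁆ =
      (if j = q then dX p i x else 0) + (if i = q then dX p j x else 0) +
      (if i = p then dX j q x else 0) + (if j = p then dX i q x else 0) := by
  rw [dX_lie]
  simp only [dX_X_eq_add, sub_eq_add_neg, CharTwo.neg_eq, mul_add, add_mul,
    Finset.sum_add_distrib, mul_ite, ite_mul, mul_one, one_mul, mul_zero, zero_mul]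
  simp only [ite_and, Finset.sum_ite_eq, Finset.mem_univ, if_true]
  split_ifs <;> simp [*] <;> ring

/-- A symmetric family of scalars that vanishes on the diagonal is the matrix of the corresponding
combination of the `X_{i,j}`. In particular the `X_{i,j}` with `i < j` span `𝔬_I^{(1)}(n)`. -/
theorem dX_sum_X (A : Fin n → Fin n → K) (hA : ∀ i j, A i j = A j i) (h0 : ∀ i, A i i = 0)
    (p q : Fin n) :
    dX p q (∑ i, ∑ j, if i < j then A i j • X i j else 0 : OI1 K n) = A p q := by
  have key (i j : Fin n) : dX p q (if i < j then A i j • X i j else 0 : OI1 K n) =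
      (if i = p then if j = q then if p < q then A p q else 0 else 0 else 0) +
      (if j = p then if i = q then if q < p then A q p else 0 else 0 else 0) := by
    split_ifs <;> simp_all [dX_X_eq_add]
  simp only [map_sum, key, Finset.sum_add_distrib]
  rw [Finset.sum_comm (f := fun i j => if j = p then _ else _)]
  simp only [Finset.sum_ite_irrel, Finset.sum_const_zero, Finset.sum_ite_eq', Finset.mem_univ,
    if_true]
  rcases lt_trichotomy p q with h | rfl | h
  · simp [h, h.le]
  · simp [h0]
  · simp [h, h.le, hA p q]

theorem eq_sum_X (x : OI1 K n) :
    x = ∑ i, ∑ j, if i < j then dX i j x • X i j else 0 :=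
  ext_dX fun p q =>
    (dX_sum_X (fun i j => dX i j x) (dX_comm x) (dX_self x) p q).symm

/-- An element is determined by its entries above the diagonal. -/
theorem ext_dX_of_lt {x y : OI1 K n} (h : ∀ i j, i < j → dX i j x = dX i j y) : x = y := by
  refine ext_dX fun i j => ?_
  rcases lt_trichotomy i j with hij | rfl | hij
  · exact h i j hij
  · rw [dX_self, dX_self]
  · rw [dX_comm x, dX_comm y]
    exact h j i hij

theorem cochain_ext {f g : oneCochain K (OI1 K n) (OI1 K n)}
    (h : ∀ i j p q, i < j → p < q → dX p q (f (X i j)) = dX p q (g (X i j))) : f = g := by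
  refine LinearMap.ext fun x => ?_
  rw [eq_sum_X x]
  simp only [map_sum]
  refine Finset.sum_congr rfl fun i _ => Finset.sum_congr rfl fun j _ => ?_
  split_ifs with hij
  · rw [map_smul, map_smul]
    congr 1
    exact ext_dX_of_lt fun p q hpq => h i j p q hij hpq
  · rw [map_zero, map_zero]

end OI1

/-! ### Bases of first cohomology -/

/-- A finite family of cochains is a basis of cohomology as soon as its members are cocycles, only
the trivial linear combination of them is a coboundary, and every cocycle is a linear combination of
them up to a coboundary. -/
theorem isCohomologyBasis_of_fintype {ι R L : Type*} [Fintype ι] [CommRing R] [LieRing L]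
    [LieAlgebra R L] {c : ι → oneCochain R L L} (hc : ∀ i, c i ∈ oneCocycles R L L)
    (hli : ∀ a : ι → R, ∑ i, a i • c i ∈ oneCoboundaries R L L → ∀ i, a i = 0)
    (hsp : ∀ f ∈ oneCocycles R L L, ∃ a : ι → R, f - ∑ i, a i • c i ∈ oneCoboundaries R L L) :
    IsCohomologyBasis c := by
  let π := ((oneCoboundaries R L L).submoduleOf (oneCocycles R L L)).mkQ
  have hsum (a : ι → R) : ∑ i, a i • cohomologyClass (c i) (hc i) =
      π (∑ i, a i • ⟨c i, hc i⟩) := by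
    rw [map_sum]
    rfl
  have hcoe (a : ι → R) : ((∑ i, a i • ⟨c i, hc i⟩ : oneCocycles R L L) : oneCochain R L L) =
      ∑ i, a i • c i := by
    rw [Submodule.coe_sum]
    rfl
  refine ⟨hc, Fintype.linearIndependent_iff.2 fun a ha => hli a ?_, eq_top_iff.2 ?_⟩
  · rw [hsum] at ha
    have := (Submodule.Quotient.mk_eq_zero _).1 ha
    rwa [Submodule.submoduleOf, Submodule.mem_comap, Submodule.subtype_apply, hcoe] at this
  · rintro x -
    obtain ⟨⟨f, hf⟩, rfl⟩ := Submodule.mkQ_surjective _ x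
    obtain ⟨a, ha⟩ := hsp f hf
    have : π ⟨f, hf⟩ = ∑ i, a i • cohomologyClass (c i) (hc i) := by
      rw [hsum]
      refine (Submodule.Quotient.eq _).2 ?_
      rwa [Submodule.submoduleOf, Submodule.mem_comap, Submodule.subtype_apply,
        Submodule.coe_sub, hcoe]
    change π ⟨f, hf⟩ ∈ _
    rw [this]
    exact Submodule.sum_mem _ fun i _ =>
      Submodule.smul_mem _ _ (Submodule.subset_span ⟨i, rfl⟩)

theorem mem_oneCocycles_iff {R L M : Type*} [CommRing R] [LieRing L] [LieAlgebra R L]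
    [AddCommGroup M] [Module R M] [LieRingModule L M] [LieModule R L M] {f : oneCochain R L M} :
    f ∈ oneCocycles R L M ↔ ∀ x y, f ⁅x, y⁆ = ⁅x, f y⁆ - ⁅y, f x⁆ := by
  rw [oneCocycles, LinearMap.mem_ker]
  constructor
  · intro h x y
    have := d₁₂_apply_apply R L M f x y
    rw [h] at this
    exact (sub_eq_zero.1 this.symm).symm
  · intro h
    refine Subtype.ext (LinearMap.ext fun x => LinearMap.ext fun y => ?_)
    change ⁅x, f y⁆ - ⁅y, f x⁆ - f ⁅x, y⁆ = 0
    rw [h, sub_self]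

/-! ### The regular cocycles -/

namespace OI1

variable {K : Type*} [Field K] [CharP K 2] {n : ℕ}

theorem dX_regularCochain (k p q : Fin n) (x : OI1 K n) :
    dX p q (regularCochain k x) =
      ((if p = k then 1 else 0) + (if q = k then 1 else 0)) * dX p q x := by
  have h (j : Fin n) : dX p q (XdX k j k j x : OI1 K n) =
      dX k j x * ((if k = p ∧ j = q then 1 else 0) + (if j = p ∧ k = q then 1 else 0)) := by
    rw [← dX_X_eq_add]
    exact map_smul _ _ _
  have h0 : dX p q (XdX k k k k x : OI1 K n) = 0 := by rw [h, dX_self, zero_mul]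
  rw [regularCochain, LinearMap.sum_apply, map_sum,
    Finset.sum_erase (f := fun j => dX p q (XdX k j k j x : OI1 K n)) _ h0]
  simp only [h, mul_add, Finset.sum_add_distrib, mul_ite, mul_one, mul_zero, ite_and,
    Finset.sum_ite_irrel, Finset.sum_ite_eq', Finset.mem_univ, if_true, Finset.sum_const_zero]
  by_cases hp : k = p
  · subst hp
    by_cases hq : k = q
    · subst hq
      simp [dX_self]
    · simp [hq, Ne.symm hq]
  · by_cases hq : k = q
    · subst hq
      simp [hp, Ne.symm hp, dX_comm x p k]
    · simp [hp, Ne.symm hp, hq, Ne.symm hq]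

theorem regularCochain_X (k i j : Fin n) :
    regularCochain k (X i j : OI1 K n) =
      ((if i = k then 1 else 0) + (if j = k then 1 else 0) : K) • X i j := by
  refine ext_dX fun p q => ?_
  rw [dX_regularCochain, map_smul, smul_eq_mul, dX_X_eq_add]
  by_cases h1 : i = p ∧ j = q
  · rw [h1.1, h1.2]
  · by_cases h2 : j = p ∧ i = q
    · rw [h2.1, h2.2, add_comm]
    · rw [if_neg h1, if_neg h2, add_zero, mul_zero, mul_zero]

/-- `c_k` is the restriction to `𝔬_I^{(1)}(n)` of the derivation `ad E^{k,k}` of `𝔬_I(n)`. -/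
theorem regularCochain_mem_oneCocycles (k : Fin n) :
    regularCochain k ∈ oneCocycles K (OI1 K n) (OI1 K n) := by
  refine mem_oneCocycles_iff.2 fun x y => ext_dX fun p q => ?_
  rw [dX_regularCochain, map_sub, dX_lie, dX_lie, dX_lie, Finset.mul_sum,
    ← Finset.sum_sub_distrib]
  refine Finset.sum_congr rfl fun r _ => ?_
  simp only [dX_regularCochain]
  generalize (if p = k then (1 : K) else 0) = a
  generalize (if q = k then (1 : K) else 0) = b
  generalize (if r = k then (1 : K) else 0) = c
  have h2 : (2 : K) = 0 := CharTwo.two_eq_zero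
  linear_combination (-c * dX p r x * dX r q y + c * dX p r y * dX r q x) * h2

/-- The combination `∑ a_k c_k` is diagonal with eigenvalue `a_p + a_q` on `X_{p,q}`; as only
`c_1, …, c_{n-1}` occur, `a` is extended by `a_n = 0`. -/
theorem dX_sum_regularCochain {m : ℕ} (a : Fin m → K) (p q : Fin (m + 1)) (x : OI1 K (m + 1)) :
    dX p q ((∑ k, a k • regularCochain (K := K) k.castSucc) x : OI1 K (m + 1)) =
      (Fin.snoc (α := fun _ => K) a 0 p + Fin.snoc (α := fun _ => K) a 0 q) * dX p q x := by
  have h (p : Fin (m + 1)) : ∑ k : Fin m, a k * (if p = k.castSucc then 1 else 0) =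
      Fin.snoc (α := fun _ => K) a 0 p := by
    induction p using Fin.lastCases with
    | last => simp [Fin.ext_iff, Fin.snoc, fun k : Fin m => k.2.ne']
    | cast i => simp [Fin.castSucc_inj]
  rw [LinearMap.sum_apply, map_sum, ← h p, ← h q, ← Finset.sum_add_distrib, Finset.sum_mul]
  refine Finset.sum_congr rfl fun k _ => ?_
  rw [LinearMap.smul_apply, map_smul, dX_regularCochain, smul_eq_mul]
  ring

theorem dX_coboundaryZero_X (m : OI1 K n) (i j p q : Fin n) :
    dX p q (coboundaryZero K (OI1 K n) (OI1 K n) m (X i j)) =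
      (if j = q then dX p i m else 0) + (if i = q then dX p j m else 0) +
      (if i = p then dX j q m else 0) + (if j = p then dX i q m else 0) := by
  rw [← dX_lie_X, ← lie_skew, map_neg, CharTwo.neg_eq]
  rfl

/-! ### The coefficients of a cocycle -/

theorem lie_X_X {i j k : Fin n} (hij : i ≠ j) (hik : i ≠ k) (hjk : j ≠ k) :
    ⁅(X i j : OI1 K n), (X j k : OI1 K n)⁆ = X i k := by
  refine ext_dX fun p q => ?_
  rw [dX_lie_X]
  simp only [dX_X_eq_add]
  grind

/-- The identity `f X_{i,k} = [f X_{i,j}, X_{j,k}] + [X_{i,j}, f X_{j,k}]` for a cocycle `f`, in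
terms of matrix entries. -/
theorem dX_cocycle_X {f : oneCochain K (OI1 K n) (OI1 K n)} (hf : f ∈ oneCocycles K _ _)
    {i j k : Fin n} (hij : i ≠ j) (hik : i ≠ k) (hjk : j ≠ k) (p q : Fin n) :
    dX p q (f (X i k)) =
      (if k = q then dX p j (f (X i j)) else 0) + (if j = q then dX p k (f (X i j)) else 0) +
      (if j = p then dX k q (f (X i j)) else 0) + (if k = p then dX j q (f (X i j)) else 0) +
      ((if j = q then dX p i (f (X j k)) else 0) + (if i = q then dX p j (f (X j k)) else 0) +
      (if i = p then dX j q (f (X j k)) else 0) + (if j = p then dX i q (f (X j k)) else 0)) := by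
  rw [← dX_lie_X, ← dX_lie_X, ← lie_X_X hij hik hjk, mem_oneCocycles_iff.1 hf, map_sub,
    ← lie_skew, map_neg, CharTwo.neg_eq, ← lie_skew (f (X i j)), map_neg, sub_eq_add_neg, add_comm]

/-- The scalars `a` with `f X_{i,j} = (a_i + a_j) X_{i,j} + …`: they exist since the diagonal
coefficients of a cocycle add up along triangles. -/
theorem exists_diagonal_coeff {m : ℕ} {f : oneCochain K (OI1 K (m + 1)) (OI1 K (m + 1))}
    (hf : f ∈ oneCocycles K _ _) :
    ∃ a : Fin m → K, ∀ i j, i ≠ j → dX i j (f (X i j)) =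
      Fin.snoc (α := fun _ => K) a 0 i + Fin.snoc (α := fun _ => K) a 0 j := by
  refine ⟨fun i => dX i.castSucc (Fin.last m) (f (X i.castSucc (Fin.last m))), fun i j hij => ?_⟩
  induction i using Fin.lastCases with
  | last =>
    induction j using Fin.lastCases with
    | last => exact absurd rfl hij
    | cast j => rw [X_comm, dX_comm]; simp
  | cast i =>
    induction j using Fin.lastCases with
    | last => simp
    | cast j =>
      have hi := (Fin.castSucc_lt_last i).ne
      have hj := (Fin.castSucc_lt_last j).ne
      rw [Fin.snoc_castSucc, Fin.snoc_castSucc, dX_cocycle_X hf hi hij hj.symm]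
      have hji : j ≠ i := fun h => hij (h ▸ rfl)
      simp [hi.symm, hij, hji, hj.symm, X_comm (Fin.last m), dX_comm _ (Fin.last m)]

/-- The element `m` of the algebra with `f = ad m + …`: the coefficient of `X_{p,i}` in
`f X_{i,k}` does not depend on `i` and is symmetric in `p` and `k`. -/
theorem exists_inner_coeff {f : oneCochain K (OI1 K n) (OI1 K n)} (hf : f ∈ oneCocycles K _ _) :
    ∃ m : OI1 K n, ∀ i k p, i ≠ k → p ≠ i → p ≠ k → dX p i (f (X i k)) = dX p k m := by
  -- Two indices different from `p` and `k` give the same value, by the entry `(p, i)` of the relation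
  -- `X_{i,k} = [X_{i,j}, X_{j,k}]`; the symmetry is its entry `(i, j)`.
  have indep (i j k p : Fin n) (hik : i ≠ k) (hpi : p ≠ i) (hjk : j ≠ k) (hpj : p ≠ j)
      (hpk : p ≠ k) : dX p i (f (X i k)) = dX p j (f (X j k)) := by
    by_cases hij : i = j
    · rw [hij]
    · rw [dX_cocycle_X hf hij hik hjk]
      simp [hpi.symm, hpj.symm, hpk.symm, hik.symm, Ne.symm hij]
  have symm (i j k : Fin n) (hij : i ≠ j) (hik : i ≠ k) (hjk : j ≠ k) :
      dX j i (f (X i k)) = dX k i (f (X i j)) := by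
    rw [dX_comm, dX_cocycle_X hf hij hik hjk, dX_comm _ k i]
    simp [hij, hij.symm, hik.symm, hjk.symm, dX_self]
  -- For `n = 2` no such index exists, so the chosen scalars need not be symmetric; only those with
  -- `p < k` are used for the matrix of `m`.
  have (p k : Fin n) : ∃ a : K, ∀ i, i ≠ k → p ≠ i → p ≠ k →
      dX p i (f (X i k)) = a ∧ dX k i (f (X i p)) = a := by
    by_cases h : ∃ i, i ≠ k ∧ p ≠ i ∧ p ≠ k
    · obtain ⟨j, hjk, hpj, hpk⟩ := h
      refine ⟨dX p j (f (X j k)), fun i hik hpi _ => ?_⟩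
      have h1 := indep i j k p hik hpi hjk hpj hpk
      exact ⟨h1, h1 ▸ symm i k p hik hpi.symm hpk.symm⟩
    · exact ⟨0, fun i h1 h2 h3 => absurd ⟨i, h1, h2, h3⟩ h⟩
  choose A hA using this
  refine ⟨∑ i, ∑ j, if i < j then
    (fun i j => if i < j then A i j else if j < i then A j i else 0) i j • X i j else 0,
    fun i k p hik hpi hpk => ?_⟩
  rw [dX_sum_X _ (fun i j => ?_) (fun i => by simp)]
  · rcases lt_or_gt_of_ne hpk with h | h
    · rw [if_pos h]
      exact (hA p k i hik hpi hpk).1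
    · rw [if_neg h.not_gt, if_pos h]
      exact (hA k p i hpi.symm hik.symm hpk.symm).2
  · rcases lt_trichotomy i j with h | rfl | h
    · simp [h, h.not_gt]
    · rfl
    · simp [h, h.not_gt]

/-- Up to a linear combination of the `c_k` and a coboundary, the only coefficients of a cocycle are
those of `X_{p,q}` in the image of `X_{i,j}` with `{i, j}` and `{p, q}` disjoint. -/
theorem exists_sub_regular_sub_coboundary {m : ℕ}
    {f : oneCochain K (OI1 K (m + 1)) (OI1 K (m + 1))} (hf : f ∈ oneCocycles K _ _) :
    ∃ a : Fin m → K, ∃ h ∈ oneCocycles K (OI1 K (m + 1)) (OI1 K (m + 1)),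
      f - ∑ k, a k • regularCochain (K := K) k.castSucc - h ∈ oneCoboundaries K _ _ ∧
      ∀ i j p q, i ≠ j → p ≠ q → (i = p ∨ i = q ∨ j = p ∨ j = q) → dX p q (h (X i j)) = 0 := by
  obtain ⟨a, ha⟩ := exists_diagonal_coeff hf
  obtain ⟨x, hx⟩ := exists_inner_coeff hf
  let r : oneCochain K (OI1 K (m + 1)) (OI1 K (m + 1)) :=
    ∑ k, a k • regularCochain (K := K) k.castSucc
  let b := coboundaryZero K (OI1 K (m + 1)) (OI1 K (m + 1)) x
  have hr : r ∈ oneCocycles K _ _ := Submodule.sum_mem _ fun k _ =>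
    Submodule.smul_mem _ _ (regularCochain_mem_oneCocycles _)
  have hb : b ∈ oneCoboundaries K _ _ := ⟨x, rfl⟩
  refine ⟨a, f - r - b, Submodule.sub_mem _ (Submodule.sub_mem _ hf hr)
    (oneCoboundaries_le_oneCocycles _ _ _ hb), ?_, ?_⟩
  · rw [sub_sub_cancel]
    exact hb
  have entry (i j p q : Fin (m + 1)) : dX p q ((f - r - b) (X i j)) = dX p q (f (X i j)) -
      dX p q (r (X i j)) - dX p q (b (X i j)) := by
    rw [LinearMap.sub_apply, LinearMap.sub_apply, map_sub, map_sub]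
  have diag (i j : Fin (m + 1)) (hij : i ≠ j) : dX i j ((f - r - b) (X i j)) = 0 := by
    rw [entry, ha i j hij, dX_sum_regularCochain, dX_coboundaryZero_X, dX_X_eq_add]
    simp [dX_self, hij, hij.symm]
  have adj (i j p : Fin (m + 1)) (hij : i ≠ j) (hpi : p ≠ i) (hpj : p ≠ j) :
      dX p i ((f - r - b) (X i j)) = 0 := by
    rw [entry, hx i j p hij hpi hpj, dX_sum_regularCochain, dX_coboundaryZero_X, dX_X_eq_add]
    simp [hij.symm, hpi.symm, hpj.symm]
  have adj' (i j p : Fin (m + 1)) (hij : i ≠ j) (hpi : p ≠ i) :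
      dX p i ((f - r - b) (X i j)) = 0 := by
    by_cases hpj : p = j
    · rw [hpj, dX_comm, diag i j hij]
    · exact adj i j p hij hpi hpj
  rintro i j p q hij hpq (rfl | rfl | rfl | rfl)
  · rw [dX_comm, adj' i j q hij hpq.symm]
  · exact adj' i j p hij hpq
  · rw [X_comm, dX_comm, adj' j i q hij.symm hpq.symm]
  · rw [X_comm, adj' j i p hij.symm hpq]

/-- For `n ≠ 4` a cocycle has no coefficients with disjoint index pairs `{i, k}` and `{p, q}`: an
index `j` outside both gives `X_{i,k} = [X_{i,j}, X_{j,k}]`, and no matrix occurring in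
`[f X_{i,j}, X_{j,k}] + [X_{i,j}, f X_{j,k}]` has an entry at `(p, q)`. -/
theorem dX_cocycle_X_of_disjoint (hn : n ≠ 4) {f : oneCochain K (OI1 K n) (OI1 K n)}
    (hf : f ∈ oneCocycles K _ _) {i k p q : Fin n} (hik : i ≠ k) (hpq : p ≠ q) (hip : i ≠ p)
    (hiq : i ≠ q) (hkp : k ≠ p) (hkq : k ≠ q) : dX p q (f (X i k)) = 0 := by
  have hcard : ({i, k, p, q} : Finset (Fin n)).card = 4 := by
    rw [Finset.card_insert_of_notMem (by simp [hik, hip, hiq]),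
      Finset.card_insert_of_notMem (by simp [hkp, hkq]), Finset.card_pair hpq]
  obtain ⟨j, hj⟩ : ∃ j, j ∉ ({i, k, p, q} : Finset (Fin n)) := by
    by_contra! h
    rw [Finset.eq_univ_of_forall h, Finset.card_univ, Fintype.card_fin] at hcard
    exact hn hcard
  simp only [Finset.mem_insert, Finset.mem_singleton, not_or] at hj
  obtain ⟨hji, hjk, hjp, hjq⟩ := hj
  rw [dX_cocycle_X hf (Ne.symm hji) hik hjk]
  simp [hjp, hjq, hip, hiq, hkp, hkq]

/-! ### Independence and the case of dimension different from four -/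

theorem dX_coboundary_X_self {f : oneCochain K (OI1 K n) (OI1 K n)}
    (hf : f ∈ oneCoboundaries K _ _) {i j : Fin n} (hij : i ≠ j) : dX i j (f (X i j)) = 0 := by
  obtain ⟨m, rfl⟩ := hf
  rw [dX_coboundaryZero_X]
  simp [dX_self, hij, hij.symm]

theorem dX_coboundary_X_of_disjoint {f : oneCochain K (OI1 K n) (OI1 K n)}
    (hf : f ∈ oneCoboundaries K _ _) {i j p q : Fin n} (hip : i ≠ p) (hiq : i ≠ q) (hjp : j ≠ p)
    (hjq : j ≠ q) : dX p q (f (X i j)) = 0 := by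
  obtain ⟨m, rfl⟩ := hf
  rw [dX_coboundaryZero_X]
  simp [hip, hiq, hjp, hjq]

theorem isCohomologyBasis_regularCochain {m : ℕ} (hm : m + 1 ≠ 4) :
    IsCohomologyBasis fun k : Fin m => regularCochain (K := K) k.castSucc := by
  refine isCohomologyBasis_of_fintype (fun k => regularCochain_mem_oneCocycles _) ?_ ?_
  · intro a ha i
    have hi := (Fin.castSucc_lt_last i).ne
    have := dX_coboundary_X_self ha hi
    rw [dX_sum_regularCochain, dX_X_eq_add] at this
    simpa [hi, hi.symm] using this
  · intro f hf
    obtain ⟨a, h, hh, hb, h0⟩ := exists_sub_regular_sub_coboundary hf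
    have : h = 0 := by
      refine cochain_ext fun i j p q hij hpq => ?_
      rw [LinearMap.zero_apply, map_zero]
      by_cases hc : i = p ∨ i = q ∨ j = p ∨ j = q
      · exact h0 i j p q hij.ne hpq.ne hc
      · simp only [not_or] at hc
        exact dX_cocycle_X_of_disjoint hm hh hij.ne hpq.ne hc.1 hc.2.1 hc.2.2.1 hc.2.2.2
    rw [this, sub_zero] at hb
    exact ⟨a, hb⟩

/-! ### The exceptional cocycles for `n = 4` -/

theorem dX_XdX (i j k l p q : Fin n) (x : OI1 K n) :
    dX p q (XdX i j k l x) =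
      dX k l x * ((if i = p ∧ j = q then 1 else 0) + (if j = p ∧ i = q then 1 else 0)) := by
  rw [← dX_X_eq_add]
  exact map_smul _ _ _

theorem dX_exceptionalCochain_zero (p q : Fin 4) (x : OI1 K 4) :
    dX p q (exceptionalCochain 0 x) =
      dX p q (XdX 0 1 2 3 x) + dX p q (XdX 0 2 1 3 x) + dX p q (XdX 1 2 0 3 x) := rfl

theorem dX_exceptionalCochain_one (p q : Fin 4) (x : OI1 K 4) :
    dX p q (exceptionalCochain 1 x) =
      dX p q (XdX 0 1 2 3 x) + dX p q (XdX 0 3 1 2 x) + dX p q (XdX 1 3 0 2 x) := rfl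

theorem dX_exceptionalCochain_two (p q : Fin 4) (x : OI1 K 4) :
    dX p q (exceptionalCochain 2 x) =
      dX p q (XdX 0 2 1 3 x) + dX p q (XdX 0 3 1 2 x) + dX p q (XdX 2 3 0 1 x) := rfl

theorem lt_cases_fin_four {i j : Fin 4} (h : i < j) :
    (i = 0 ∧ j = 1) ∨ (i = 0 ∧ j = 2) ∨ (i = 0 ∧ j = 3) ∨ (i = 1 ∧ j = 2) ∨ (i = 1 ∧ j = 3) ∨
      (i = 2 ∧ j = 3) := by
  revert i j
  decide

-- Compares the six entries above the diagonal for each of the three cochains.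
set_option maxHeartbeats 1000000 in
theorem exceptionalCochain_mem_oneCocycles (s : Fin 3) :
    exceptionalCochain s ∈ oneCocycles K (OI1 K 4) (OI1 K 4) := by
  refine mem_oneCocycles_iff.2 fun x y => ext_dX_of_lt fun p q hpq => ?_
  have e10 (x : OI1 K 4) := dX_comm x 1 0
  have e20 (x : OI1 K 4) := dX_comm x 2 0
  have e21 (x : OI1 K 4) := dX_comm x 2 1
  have e31 (x : OI1 K 4) := dX_comm x 3 1
  have e32 (x : OI1 K 4) := dX_comm x 3 2
  rw [map_sub, dX_lie, dX_lie, ← sub_eq_zero, Fin.sum_univ_four, Fin.sum_univ_four]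
  obtain rfl | rfl | rfl : s = 0 ∨ s = 1 ∨ s = 2 := by revert s; decide
  all_goals
    simp only [dX_exceptionalCochain_zero, dX_exceptionalCochain_one, dX_exceptionalCochain_two,
      dX_XdX, dX_lie, Fin.sum_univ_four]
    rcases lt_cases_fin_four hpq with ⟨rfl, rfl⟩ | ⟨rfl, rfl⟩ | ⟨rfl, rfl⟩ | ⟨rfl, rfl⟩ |
      ⟨rfl, rfl⟩ | ⟨rfl, rfl⟩ <;>
    simp [dX_self, e10, e20, e21, e31, e32] <;> grind

-- Compares the six entries above the diagonal on each of the six basis elements.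
set_option maxHeartbeats 1000000 in
/-- In dimension `4` the coefficients with disjoint index pairs add up along triangles, so the three
of them at `X_{1,4}`, `X_{1,3}`, `X_{1,2}` determine the others. -/
theorem eq_sum_exceptionalCochain {h : oneCochain K (OI1 K 4) (OI1 K 4)}
    (hh : h ∈ oneCocycles K _ _)
    (h0 : ∀ i j p q, i ≠ j → p ≠ q → (i = p ∨ i = q ∨ j = p ∨ j = q) → dX p q (h (X i j)) = 0) :
    h = ∑ s, (![dX 1 2 (h (X 0 3)), dX 1 3 (h (X 0 2)), dX 2 3 (h (X 0 1))] : Fin 3 → K) s •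
      exceptionalCochain (K := K) s := by
  have tri (i j k p : Fin 4) (hij : i ≠ j) (hik : i ≠ k) (hjk : j ≠ k) (hip : i ≠ p) (hjp : j ≠ p)
      (hkp : k ≠ p) : dX p j (h (X i k)) = dX p k (h (X i j)) + dX p i (h (X j k)) := by
    rw [dX_cocycle_X hh hij hik hjk]
    simp [hjk.symm, hij, hjp, hkp, hip]
  have t12 : dX 0 3 (h (X 1 2)) = dX 1 3 (h (X 0 2)) + dX 2 3 (h (X 0 1)) := by
    rw [dX_comm, tri 1 0 2 3 (by decide) (by decide) (by decide) (by decide) (by decide)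
      (by decide), X_comm 1 0, dX_comm _ 3 2, dX_comm _ 3 1, add_comm]
  have t13 : dX 0 2 (h (X 1 3)) = dX 1 2 (h (X 0 3)) + dX 2 3 (h (X 0 1)) := by
    rw [dX_comm, tri 1 0 3 2 (by decide) (by decide) (by decide) (by decide) (by decide)
      (by decide), X_comm 1 0, dX_comm _ 2 1, add_comm]
  have t23 : dX 0 1 (h (X 2 3)) = dX 1 2 (h (X 0 3)) + dX 1 3 (h (X 0 2)) := by
    rw [dX_comm, tri 2 0 3 1 (by decide) (by decide) (by decide) (by decide) (by decide)
      (by decide), X_comm 2 0, add_comm]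
  refine cochain_ext fun i j p q hij hpq => ?_
  rw [Fin.sum_univ_three]
  simp only [LinearMap.add_apply, LinearMap.smul_apply, map_add, map_smul,
    dX_exceptionalCochain_zero, dX_exceptionalCochain_one, dX_exceptionalCochain_two, dX_XdX,
    dX_X_eq_add]
  rcases lt_cases_fin_four hij with ⟨rfl, rfl⟩ | ⟨rfl, rfl⟩ | ⟨rfl, rfl⟩ | ⟨rfl, rfl⟩ |
    ⟨rfl, rfl⟩ | ⟨rfl, rfl⟩ <;>
  rcases lt_cases_fin_four hpq with ⟨rfl, rfl⟩ | ⟨rfl, rfl⟩ | ⟨rfl, rfl⟩ | ⟨rfl, rfl⟩ |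
    ⟨rfl, rfl⟩ | ⟨rfl, rfl⟩ <;>
  first
  | (rw [h0 _ _ _ _ (by decide) (by decide) (by decide)]; simp)
  | simp [t12, t13, t23]

theorem isCohomologyBasis_four :
    IsCohomologyBasis (Sum.elim
      (fun k : Fin 3 => regularCochain (K := K) (n := 4) k.castSucc)
      (exceptionalCochain (K := K))) := by
  refine isCohomologyBasis_of_fintype (fun i => ?_) (fun a ha => ?_) (fun f hf => ?_)
  · rcases i with k | s
    · exact regularCochain_mem_oneCocycles _
    · exact exceptionalCochain_mem_oneCocycles s
  · rw [Fintype.sum_sum_type] at ha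
    simp only [Sum.elim_inl, Sum.elim_inr] at ha
    have entry (i j p q : Fin 4) :
        dX p q ((∑ k, a (.inl k) • regularCochain (K := K) k.castSucc +
          ∑ s, a (.inr s) • exceptionalCochain (K := K) s) (X i j : OI1 K 4)) =
        (Fin.snoc (α := fun _ => K) (fun k => a (.inl k)) 0 p +
          Fin.snoc (α := fun _ => K) (fun k => a (.inl k)) 0 q) * dX p q (X i j : OI1 K 4) +
        (a (.inr 0) * dX p q (exceptionalCochain 0 (X i j : OI1 K 4)) +
          a (.inr 1) * dX p q (exceptionalCochain 1 (X i j : OI1 K 4)) +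
          a (.inr 2) * dX p q (exceptionalCochain 2 (X i j : OI1 K 4))) := by
      rw [LinearMap.add_apply, map_add, dX_sum_regularCochain, Fin.sum_univ_three]
      rfl
    -- The coefficient of `X_{i,4}` in the image of `X_{i,4}` is that of `c_i`: inner derivations and
    -- exceptional cochains do not contribute to it.
    have reg (i : Fin 3) : a (.inl i) = 0 := by
      have hi := (Fin.castSucc_lt_last i).ne
      have h := dX_coboundary_X_self ha hi
      rw [entry, Fin.snoc_castSucc, Fin.snoc_last] at h
      obtain rfl | rfl | rfl : i = 0 ∨ i = 1 ∨ i = 2 := by clear h hi; revert i; decide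
      all_goals
        simpa [dX_exceptionalCochain_zero, dX_exceptionalCochain_one, dX_exceptionalCochain_two,
          dX_XdX, dX_X_eq_add, Fin.ext_iff] using h
    -- Coefficients with disjoint index pairs come from the exceptional cochains only, and on
    -- `X_{1,4}`, `X_{1,3}`, `X_{1,2}` from exactly one of them.
    have e0 : a (.inr 0) = 0 := by
      have h := dX_coboundary_X_of_disjoint ha (i := 0) (j := 3) (p := 1) (q := 2)
        (by decide) (by decide) (by decide) (by decide)
      rw [entry] at h
      simpa [dX_exceptionalCochain_zero, dX_exceptionalCochain_one, dX_exceptionalCochain_two,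
        dX_XdX, dX_X_eq_add] using h
    have e1 : a (.inr 1) = 0 := by
      have h := dX_coboundary_X_of_disjoint ha (i := 0) (j := 2) (p := 1) (q := 3)
        (by decide) (by decide) (by decide) (by decide)
      rw [entry] at h
      simpa [dX_exceptionalCochain_zero, dX_exceptionalCochain_one, dX_exceptionalCochain_two,
        dX_XdX, dX_X_eq_add] using h
    have e2 : a (.inr 2) = 0 := by
      have h := dX_coboundary_X_of_disjoint ha (i := 0) (j := 1) (p := 2) (q := 3)
        (by decide) (by decide) (by decide) (by decide)
      rw [entry] at h
      simpa [dX_exceptionalCochain_zero, dX_exceptionalCochain_one, dX_exceptionalCochain_two,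
        dX_XdX, dX_X_eq_add] using h
    rintro (k | s)
    · exact reg k
    · obtain rfl | rfl | rfl : s = 0 ∨ s = 1 ∨ s = 2 := by revert s; decide
      exacts [e0, e1, e2]
  · obtain ⟨a, h, hh, hb, h0⟩ := exists_sub_regular_sub_coboundary hf
    rw [eq_sum_exceptionalCochain hh h0, sub_sub] at hb
    refine ⟨Sum.elim a ![dX 1 2 (h (X 0 3)), dX 1 3 (h (X 0 2)), dX 2 3 (h (X 0 1))], ?_⟩
    rw [Fintype.sum_sum_type]
    exact hb

/-! ### Degrees -/

section Grading

variable {Γ : Type*} [AddCommGroup Γ] [DecidableEq Γ]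

/-- Projecting `x = ∑ x_{a,b} X_{a,b}` to the component of degree `i` writes a homogeneous element
of degree `i` as a combination of those `X_{a,b}` that have degree `i`; each of these is an
eigenvector of `c_k`. -/
theorem hasDegree_zero_regularCochain (𝒢 : Γ → Submodule K (OI1 K n)) [GradedLieAlgebra 𝒢]
    (hX : ∀ i j : Fin n, SetLike.IsHomogeneousElem 𝒢 (X i j : OI1 K n)) (k : Fin n) :
    HasDegree 𝒢 0 (regularCochain k) := by
  intro i x hx
  rw [add_zero]
  let π : OI1 K n →ₗ[K] OI1 K n := (𝒢 i).subtype ∘ₗ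
    DirectSum.component K Γ (fun d => 𝒢 d) i ∘ₗ (DirectSum.decomposeLinearEquiv 𝒢).toLinearMap
  have hx' : x = π (∑ a, ∑ b, if a < b then dX a b x • X a b else 0) := by
    rw [← eq_sum_X x]
    exact (DirectSum.decompose_of_mem_same 𝒢 hx).symm
  rw [hx']
  simp only [map_sum]
  refine Submodule.sum_mem _ fun a _ => Submodule.sum_mem _ fun b _ => ?_
  split_ifs
  · rw [map_smul, map_smul]
    refine Submodule.smul_mem _ _ ?_
    obtain ⟨d, hd⟩ := hX a b
    by_cases hdi : d = i
    · subst hdi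
      rw [show π (X a b) = X a b from DirectSum.decompose_of_mem_same 𝒢 hd, regularCochain_X]
      exact Submodule.smul_mem _ _ hd
    · rw [show π (X a b) = 0 from DirectSum.decompose_of_mem_ne 𝒢 hd hdi, map_zero]
      exact Submodule.zero_mem _
  · rw [map_zero, map_zero]
    exact Submodule.zero_mem _

/-- The relations `[X_{i,j}, X_{j,k}] = X_{i,k}` and `[X_{i,k}, X_{k,j}] = X_{i,j}` show that twice
the degree of `X_{j,k}` is zero. -/
theorem X_mem_zero [IsAddTorsionFree Γ] (hn : 3 ≤ n) (𝒢 : Γ → Submodule K (OI1 K n))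
    [GradedLieAlgebra 𝒢] (hX : ∀ i j : Fin n, SetLike.IsHomogeneousElem 𝒢 (X i j : OI1 K n))
    (j k : Fin n) : X j k ∈ 𝒢 0 := by
  by_cases hjk : j = k
  · subst hjk
    have : (X j j : OI1 K n) = 0 := ext_dX fun p q => by
      rw [dX_X_eq_add, CharTwo.add_self_eq_zero, map_zero]
    rw [this]
    exact Submodule.zero_mem _
  obtain ⟨i, hi⟩ : ∃ i, i ∉ ({j, k} : Finset (Fin n)) := by
    by_contra! h
    have := Finset.card_pair hjk
    rw [Finset.eq_univ_of_forall h, Finset.card_univ, Fintype.card_fin] at this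
    omega
  simp only [Finset.mem_insert, Finset.mem_singleton, not_or] at hi
  obtain ⟨d, hd⟩ := hX j k
  obtain ⟨e, he⟩ := hX i j
  have h1 := SetLike.GradedBracket.bracket_mem he hd
  rw [lie_X_X hi.1 hi.2 hjk] at h1
  rw [X_comm] at hd
  have h2 := SetLike.GradedBracket.bracket_mem h1 hd
  rw [lie_X_X hi.2 hi.1 (Ne.symm hjk)] at h2
  have hne : (X i j : OI1 K n) ≠ 0 := fun h => by
    have := dX_X_eq_add (K := K) i j i j
    simp [h, hi.1, Ne.symm hi.1] at this
  have hdeg := DirectSum.degree_eq_of_mem_mem 𝒢 he h2 hne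
  have hd0 : d = 0 := by
    rw [add_assoc, left_eq_add, ← two_nsmul] at hdeg
    exact (nsmul_eq_zero_iff_right two_ne_zero).1 hdeg
  rw [X_comm, ← hd0]
  exact hd

theorem hasDegree_zero_of_torsionFree [IsAddTorsionFree Γ] (hn : 3 ≤ n)
    (𝒢 : Γ → Submodule K (OI1 K n)) [GradedLieAlgebra 𝒢]
    (hX : ∀ i j : Fin n, SetLike.IsHomogeneousElem 𝒢 (X i j : OI1 K n))
    (f : oneCochain K (OI1 K n) (OI1 K n)) : HasDegree 𝒢 0 f := by
  have mem (x : OI1 K n) : x ∈ 𝒢 0 := by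
    rw [eq_sum_X x]
    refine Submodule.sum_mem _ fun a _ => Submodule.sum_mem _ fun b _ => ?_
    split_ifs
    · exact Submodule.smul_mem _ _ (X_mem_zero hn 𝒢 hX a b)
    · exact Submodule.zero_mem _
  intro i x hx
  by_cases h : x = 0
  · rw [h, map_zero]
    exact Submodule.zero_mem _
  · rw [DirectSum.degree_eq_of_mem_mem 𝒢 hx (mem x) h, add_zero]
    exact mem _

end Grading

end OI1

theorem mainTheorem3 (K : Type*) [Field K] [CharP K 2] :
    (∀ n : ℕ, 1 ≤ n → n ≠ 4 →
      IsCohomologyBasis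
        (fun k : Fin (n - 1) =>
          OI1.regularCochain (K := K) (n := n) (k.castLE (Nat.sub_le n 1)))) ∧
    IsCohomologyBasis
      (Sum.elim
        (fun k : Fin 3 => OI1.regularCochain (K := K) (n := 4) (k.castLE (by decide)))
        (OI1.exceptionalCochain (K := K))) ∧
    (∀ (n : ℕ) (Γ : Type) [AddCommGroup Γ] [DecidableEq Γ]
      (𝒢 : Γ → Submodule K (OI1 K n)) [GradedLieAlgebra 𝒢],
      (∀ i j : Fin n, SetLike.IsHomogeneousElem 𝒢 (OI1.X i j : OI1 K n)) →
        ∀ k : Fin n, HasDegree 𝒢 0 (OI1.regularCochain k)) ∧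
    (∀ (𝒢 : ℤ → Submodule K (OI1 K 4)) [GradedLieAlgebra 𝒢],
      (∀ i j : Fin 4, SetLike.IsHomogeneousElem 𝒢 (OI1.X i j : OI1 K 4)) →
        ∀ s : Fin 3, HasDegree 𝒢 0 (OI1.exceptionalCochain s)) := by
  refine ⟨fun n hn h4 => ?_, OI1.isCohomologyBasis_four, fun n Γ _ _ 𝒢 _ hX k =>
    OI1.hasDegree_zero_regularCochain 𝒢 hX k, fun 𝒢 _ hX s =>
    OI1.hasDegree_zero_of_torsionFree (by decide) 𝒢 hX _⟩
  obtain ⟨m, rfl⟩ : ∃ m, n = m + 1 := ⟨n - 1, by omega⟩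
  exact OI1.isCohomologyBasis_regularCochain h4
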